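/- Let $\mathbb D\subset\mathbb C$ be the open unit disc and, for $n\ge 1$, let $\pi_n=(\pi_{n,1},\dots,\pi_{n,n}):\mathbb C^n\to\mathbb C^n$, $\pi_{n,k}(\lambda_1,\dots,\lambda_n)=\sum_{1\le j_1<\dots<j_k\le n}\lambda_{j_1}\cdots\lambda_{j_k}$, be the symmetrization map; let $\mathbb G_n=\pi_n(\mathbb D^n)$ be the symmetrized polydisc. A domain $D\subset\mathbb C^n$ (a nonempty connected open set) is called hyperconvex if it has a negative plurisubharmonic exhaustion, i.e. a plurisubharmonic function $u:D\to[-\infty,0)$ (not identically $-\infty$) such that for every $\epsilon>0$ the set $\{z\in D: u(z)<-\epsilon\}$ is relatively compact in $D$. Then for every $n\ge1$ the set $\mathbb G_n$ is a hyperconvex domain. More precisely, for every $w\in\mathbb C^n$ the maximum $$u(w)=\max\bigl\{\log\max_{1\le j\le n}|\lambda_j| \;:\; \lambda\in\mathbb C^n,\ \pi_n(\lambda)=w\bigr\}\in[-\infty,\infty)$$ (with $\log 0=-\infty$) is attained, and the restriction of $u$ to $\mathbb G_n$ is a negative plurisubharmonic exhaustion of $\mathbb G_n$. -/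

import Mathlib

/-- The mean value over the unit circle of an extended real valued function, in the sense of
Lebesgue: the mean of the positive part minus the mean of the negative part. (For an upper
semicontinuous function with values in `[-∞, ∞)` the first mean is finite, so the difference is
always meaningful, possibly `-∞`.) -/
noncomputable def unitCircleMean (f : ℂ → EReal) : EReal :=
  ((MeasureTheory.laverage (MeasureTheory.volume.restrict (Set.Ioc (0 : ℝ) (2 * Real.pi)))
      fun θ => (f (circleMap 0 1 θ)).toENNReal : ENNReal) : EReal) -
    ((MeasureTheory.laverage (MeasureTheory.volume.restrict (Set.Ioc (0 : ℝ) (2 * Real.pi)))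
      fun θ => (-f (circleMap 0 1 θ)).toENNReal : ENNReal) : EReal)

/-- `u` is plurisubharmonic on the (open) set `D`: it takes values in `[-∞, ∞)` on `D`, is not
identically `-∞` on any connected component of `D`, is upper semicontinuous, and satisfies the
sub-mean value inequality on every closed complex affine disc contained in `D`.
Values of `u` outside `D` play no role. -/
structure IsPlurisubharmonicOn {E : Type*} [NormedAddCommGroup E] [NormedSpace ℂ E]
    (u : E → EReal) (D : Set E) : Prop where
  lt_top : ∀ z ∈ D, u z < ⊤
  ne_bot : ∀ z ∈ D, ∃ w ∈ connectedComponentIn D z, u w ≠ ⊥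
  upperSemicontinuousOn : UpperSemicontinuousOn u D
  le_mean : ∀ a b : E, (∀ ζ : ℂ, ‖ζ‖ ≤ 1 → a + ζ • b ∈ D) →
    u a ≤ unitCircleMean (fun ζ => u (a + ζ • b))

/-- `u` is a negative plurisubharmonic exhaustion of `D`: it is plurisubharmonic and negative on
`D`, and for every `ε > 0` the set `{z ∈ D : u z < -ε}` is relatively compact in `D`. -/
structure IsNegPSHExhaustion {E : Type*} [NormedAddCommGroup E] [NormedSpace ℂ E]
    (u : E → EReal) (D : Set E) : Prop where
  psh : IsPlurisubharmonicOn u D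
  neg : ∀ z ∈ D, u z < 0
  isCompact_closure : ∀ ε : ℝ, 0 < ε → IsCompact (closure {z ∈ D | u z < ((-ε : ℝ) : EReal)})
  closure_subset : ∀ ε : ℝ, 0 < ε → closure {z ∈ D | u z < ((-ε : ℝ) : EReal)} ⊆ D

/-- `D` is a hyperconvex domain: a (nonempty, open, connected) domain which admits a negative
plurisubharmonic exhaustion. -/
def IsHyperconvexDomain {E : Type*} [NormedAddCommGroup E] [NormedSpace ℂ E]
    (D : Set E) : Prop :=
  IsOpen D ∧ IsConnected D ∧ ∃ u : E → EReal, IsNegPSHExhaustion u D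

/-- The symmetrization map `π_n : ℂⁿ → ℂⁿ`. The coordinate with index `k : Fin n` is the elementary
symmetric polynomial of degree `k + 1`. -/
def symmetrization (n : ℕ) (z : Fin n → ℂ) : Fin n → ℂ :=
  fun k => ∑ s ∈ Finset.powersetCard ((k : ℕ) + 1) (Finset.univ : Finset (Fin n)), ∏ j ∈ s, z j

/-- The symmetrized polydisc `𝔾_n = π_n(𝔻ⁿ)`. -/
def symmetrizedPolydisc (n : ℕ) : Set (Fin n → ℂ) :=
  symmetrization n '' {z | ∀ j, ‖z j‖ < 1}

/-- `log max_j |z_j|`, with values in `[-∞, ∞)` and with `log 0 = -∞`. -/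
noncomputable def logMaxAbs {n : ℕ} (z : Fin n → ℂ) : EReal :=
  ENNReal.log (⨆ j, ‖z j‖ₑ)

/-- `u(w) = sup {log max_j |z_j| : π_n(z) = w}`. -/
noncomputable def logMaxRoot (n : ℕ) (w : Fin n → ℂ) : EReal :=
  sSup (logMaxAbs '' (symmetrization n ⁻¹' {w}))

/-! The fibres of `symmetrization n` are the orderings of a root multiset, so `logMaxRoot n
(symmetrization n z)` is `log ‖z‖`. Hence the maximum is attained and 𝔾_n is the set where u < 0.
Root bounds make the map proper, hence closed, which gives openness and upper semicontinuity; the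
sublevel sets lie in images of closed balls of radius < 1. The heart is the sub-mean value
inequality. By the fundamental theorem of symmetric polynomials, e_{m+1}(z_1^k, …, z_n^k) is a
polynomial P_{k,m} in w = π_n(z). Always |P_{k,m}(w)| ≤ 2^n ‖z‖^{k(m+1)}, while ‖z‖^{k(m+1)} ≤ n
|P_{k,m}(w)| for some m when z ≠ 0. So u is, up to O(1/k), the maximum over m of log|P_{k,m}| /
(k(m+1)); Jensen's inequality applies to each of these, and k → ∞ removes the error. -/

/-! ### Fibres of the symmetrization map and the value of u -/

open Polynomial in
theorem prod_X_add_C_eq_symmetrization {n : ℕ} (z : Fin n → ℂ) :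
    ∏ j, (X + C (z j)) = X ^ n + ∑ k : Fin n, C (symmetrization n z k) * X ^ (n - 1 - (k : ℕ)) := by
  have h := Multiset.prod_X_add_C_eq_sum_esymm ((Finset.univ : Finset (Fin n)).val.map z)
  have hc : ((Finset.univ : Finset (Fin n)).val.map z).card = n := by simp
  rw [Multiset.map_map, Function.comp_def, Finset.prod_map_val] at h
  rw [h]
  rw [hc, Finset.sum_range_succ', Finset.sum_range, add_comm]
  refine congrArg₂ (· + ·) ?_ (Finset.sum_congr rfl fun k _ => ?_)
  · rw [Finset.esymm_map_val, Finset.powersetCard_zero, Finset.sum_singleton, Finset.prod_empty,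
      C_1, one_mul, Nat.sub_zero]
  · rw [Finset.esymm_map_val, symmetrization, show n - ((k : ℕ) + 1) = n - 1 - k by omega]

open Polynomial in
theorem coeff_X_pow_add_sum_rev {n : ℕ} (w : Fin n → ℂ) (k : Fin n) :
    (X ^ n + ∑ i : Fin n, C (w i) * X ^ (n - 1 - (i : ℕ))).coeff (n - 1 - (k : ℕ)) = w k := by
  have hk := k.isLt
  rw [coeff_add, coeff_X_pow, if_neg (by omega), zero_add, finsetSum_coeff,
    Finset.sum_eq_single k]
  · simp
  · intro b _ hb
    have := b.isLt
    have : (b : ℕ) ≠ k := fun h => hb (Fin.ext h)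
    rw [coeff_C_mul, coeff_X_pow, if_neg (by omega), mul_zero]
  · simp

open Polynomial in
theorem symmetrization_surjective (n : ℕ) : Function.Surjective (symmetrization n) := by
  intro w
  set p : ℂ[X] := X ^ n + ∑ i : Fin n, C (w i) * X ^ (n - 1 - (i : ℕ)) with hp
  have hdeg : (∑ i : Fin n, C (w i) * X ^ (n - 1 - (i : ℕ))).degree < (n : WithBot ℕ) := by
    refine (degree_sum_le _ _).trans_lt ((Finset.sup_lt_iff (WithBot.bot_lt_coe n)).2 ?_)
    intro i _
    refine (degree_C_mul_X_pow_le _ _).trans_lt ?_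
    have := i.isLt
    exact Nat.cast_lt.2 (by omega : n - 1 - (i : ℕ) < n)
  have hmon : p.Monic := monic_X_pow_add hdeg
  have hnat : p.natDegree = n := by
    refine natDegree_eq_of_degree_eq_some ?_
    rw [hp, degree_add_eq_left_of_degree_lt (by rwa [degree_X_pow]), degree_X_pow]
  have hsplit := IsAlgClosed.splits p
  have hcard : p.roots.card = n := by rw [← hnat]; exact hsplit.natDegree_eq_card_roots.symm
  obtain ⟨l, hl⟩ : ∃ l : List ℂ, (l : Multiset ℂ) = p.roots := ⟨_, p.roots.coe_toList⟩
  have hlen : l.length = n := by rw [← hcard, ← hl, Multiset.coe_card]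
  subst hlen
  refine ⟨fun j => -l.get j, ?_⟩
  have hprod : ∏ j, (X + C (-l.get j)) = p := by
    rw [hsplit.eq_prod_roots_of_monic hmon, ← hl, Multiset.map_coe, Multiset.prod_coe,
      ← List.prod_ofFn]
    congr 1
    refine List.ext_get (by simp) fun i h₁ h₂ => ?_
    simp [sub_eq_add_neg]
  rw [prod_X_add_C_eq_symmetrization] at hprod
  funext k
  rw [← coeff_X_pow_add_sum_rev (symmetrization _ _) k, hprod, hp, coeff_X_pow_add_sum_rev]

-- The roots of ∏ (X + z_j) are the -z_j, so the coefficients determine the multiset of the z_j.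
open Polynomial in
theorem map_univ_eq_of_symmetrization_eq {n : ℕ} {z z' : Fin n → ℂ}
    (h : symmetrization n z = symmetrization n z') :
    (Finset.univ : Finset (Fin n)).val.map z = Finset.univ.val.map z' := by
  have key : ∀ y : Fin n → ℂ, (∏ j, (X + C (y j))).roots
      = (Finset.univ.val.map y).map fun a => -a := by
    intro y
    rw [show ∏ j, (X + C (y j)) = ((Finset.univ.val.map fun j => -y j).map fun a => X - C a).prod by
      rw [Multiset.map_map]; simp [Finset.prod], roots_multiset_prod_X_sub_C, Multiset.map_map]
    rfl
  have h₁ := key z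
  rw [prod_X_add_C_eq_symmetrization, h, ← prod_X_add_C_eq_symmetrization, key z'] at h₁
  exact (Multiset.map_injective neg_injective h₁).symm

theorem norm_eq_of_symmetrization_eq {n : ℕ} {z z' : Fin n → ℂ}
    (h : symmetrization n z = symmetrization n z') : ‖z‖ = ‖z'‖ := by
  have key : ∀ {y y' : Fin n → ℂ}, symmetrization n y = symmetrization n y' → ‖y‖ ≤ ‖y'‖ := by
    intro y y' h
    refine (pi_norm_le_iff_of_nonneg (norm_nonneg _)).2 fun j => ?_
    have hj : y j ∈ Finset.univ.val.map y' := by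
      rw [← map_univ_eq_of_symmetrization_eq h]
      exact Multiset.mem_map_of_mem _ (Finset.mem_univ_val j)
    obtain ⟨i, -, hi⟩ := Multiset.mem_map.1 hj
    exact hi ▸ norm_le_pi_norm y' i
  exact le_antisymm (key h) (key h.symm)

theorem logMaxAbs_eq {n : ℕ} (z : Fin n → ℂ) : logMaxAbs z = ENNReal.log ‖z‖ₑ := by
  rw [logMaxAbs, enorm_eq_nnnorm, Pi.nnnorm_def, ENNReal.coe_finset_sup, Finset.sup_univ_eq_iSup]
  rfl

theorem logMaxAbs_image_fiber {n : ℕ} (z : Fin n → ℂ) :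
    logMaxAbs '' (symmetrization n ⁻¹' {symmetrization n z}) = {ENNReal.log ‖z‖ₑ} := by
  ext x
  simp only [Set.mem_image, Set.mem_preimage, Set.mem_singleton_iff, logMaxAbs_eq]
  constructor
  · rintro ⟨y, hy, rfl⟩
    rw [← ofReal_norm, norm_eq_of_symmetrization_eq hy, ofReal_norm]
  · rintro rfl
    exact ⟨z, rfl, rfl⟩

theorem logMaxRoot_symmetrization {n : ℕ} (z : Fin n → ℂ) :
    logMaxRoot n (symmetrization n z) = ENNReal.log ‖z‖ₑ := by
  rw [logMaxRoot, logMaxAbs_image_fiber, sSup_singleton]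

theorem isGreatest_logMaxRoot (n : ℕ) (w : Fin n → ℂ) :
    IsGreatest (logMaxAbs '' (symmetrization n ⁻¹' {w})) (logMaxRoot n w) := by
  obtain ⟨z, rfl⟩ := symmetrization_surjective n w
  rw [logMaxAbs_image_fiber, logMaxRoot_symmetrization]
  exact isGreatest_singleton

/-! ### Properness, topology of 𝔾_n and sublevel sets -/

theorem continuous_symmetrization (n : ℕ) : Continuous (symmetrization n) := by
  unfold symmetrization
  fun_prop

open Polynomial in
theorem norm_pow_le_sum_norm_symmetrization {n : ℕ} (z : Fin n → ℂ) (j : Fin n) :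
    ‖z j‖ ^ n ≤ ∑ k : Fin n, ‖symmetrization n z k‖ * ‖z j‖ ^ (n - 1 - (k : ℕ)) := by
  have h := congrArg (eval (-z j)) (prod_X_add_C_eq_symmetrization z)
  rw [eval_prod, Finset.prod_eq_zero (Finset.mem_univ j) (by simp)] at h
  simp only [eval_add, eval_pow, eval_X, eval_finsetSum, eval_mul, eval_C] at h
  rw [← norm_neg (z j), ← norm_pow, eq_neg_of_add_eq_zero_left h.symm, norm_neg]
  refine (norm_sum_le _ _).trans (Finset.sum_le_sum fun k _ => ?_)
  rw [norm_mul, norm_pow]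

/-- Cauchy's root bound: if |z_j| ≥ 1, every power in the preceding estimate is at most |z_j|^(n-1),
which cancels. -/
theorem norm_le_max_sum_norm_symmetrization {n : ℕ} (z : Fin n → ℂ) :
    ‖z‖ ≤ max 1 (∑ k, ‖symmetrization n z k‖) := by
  refine (pi_norm_le_iff_of_nonneg (by positivity)).2 fun j => ?_
  rcases le_total ‖z j‖ 1 with h | h
  · exact h.trans (le_max_left _ _)
  refine le_trans ?_ (le_max_right _ _)
  have hn : n - 1 + 1 = n := by have := j.isLt; omega
  have h₁ := norm_pow_le_sum_norm_symmetrization z j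
  have h₂ : ‖z j‖ * ‖z j‖ ^ (n - 1) ≤ (∑ k, ‖symmetrization n z k‖) * ‖z j‖ ^ (n - 1) := by
    rw [← pow_succ', hn, Finset.sum_mul]
    refine h₁.trans (Finset.sum_le_sum fun k _ => ?_)
    exact mul_le_mul_of_nonneg_left (pow_le_pow_right₀ h (by omega)) (norm_nonneg _)
  exact le_of_mul_le_mul_right h₂ (by positivity)

theorem isProperMap_symmetrization (n : ℕ) : IsProperMap (symmetrization n) := by
  refine isProperMap_iff_isCompact_preimage.2 ⟨continuous_symmetrization n, fun K hK => ?_⟩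
  refine Metric.isCompact_of_isClosed_isBounded
    (hK.isClosed.preimage (continuous_symmetrization n)) ?_
  obtain ⟨M, hM⟩ := hK.isBounded.exists_norm_le
  refine isBounded_iff_forall_norm_le.2 ⟨max 1 (n * M), fun z hz => ?_⟩
  refine (norm_le_max_sum_norm_symmetrization z).trans (max_le_max le_rfl ?_)
  calc ∑ k, ‖symmetrization n z k‖ ≤ ∑ _k : Fin n, M :=
        Finset.sum_le_sum fun k _ => (norm_le_pi_norm _ k).trans (hM _ hz)
    _ = n * M := by simp

theorem isOpen_logMaxRoot_lt (n : ℕ) (c : EReal) : IsOpen {w | logMaxRoot n w < c} := by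
  rw [← isClosed_compl_iff]
  -- The norm is constant on fibres, so the complement is the image of a closed set under a closed
  -- map.
  have : {w | logMaxRoot n w < c}ᶜ = symmetrization n '' {z | c ≤ ENNReal.log ‖z‖ₑ} := by
    ext w
    obtain ⟨z, rfl⟩ := symmetrization_surjective n w
    simp only [Set.mem_compl_iff, Set.mem_ofPred_eq, not_lt, Set.mem_image,
      logMaxRoot_symmetrization]
    constructor
    · exact fun h => ⟨z, h, rfl⟩
    · rintro ⟨y, hy, hyz⟩
      rwa [← logMaxRoot_symmetrization, ← hyz, logMaxRoot_symmetrization]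
  rw [this]
  refine (isProperMap_symmetrization n).isClosedMap _ (isClosed_le continuous_const ?_)
  exact ENNReal.continuous_log.comp continuous_enorm

theorem symmetrizedPolydisc_eq_image_ball (n : ℕ) :
    symmetrizedPolydisc n = symmetrization n '' Metric.ball 0 1 := by
  unfold symmetrizedPolydisc
  congr 1
  ext z
  simp [pi_norm_lt_iff]

theorem symmetrizedPolydisc_eq_setOf_lt (n : ℕ) :
    symmetrizedPolydisc n = {w | logMaxRoot n w < 0} := by
  ext w
  obtain ⟨z, rfl⟩ := symmetrization_surjective n w
  have key : ∀ y : Fin n → ℂ, ‖y‖ₑ < 1 ↔ ‖y‖ < 1 := fun y => by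
    rw [← ofReal_norm, ENNReal.ofReal_lt_one]
  rw [symmetrizedPolydisc_eq_image_ball, Set.mem_ofPred_eq, logMaxRoot_symmetrization,
    ENNReal.log_lt_zero_iff, key]
  constructor
  · rintro ⟨y, hy, hyz⟩
    rw [← norm_eq_of_symmetrization_eq hyz]
    simpa using hy
  · exact fun h => ⟨z, by simpa using h, rfl⟩

theorem isOpen_symmetrizedPolydisc (n : ℕ) : IsOpen (symmetrizedPolydisc n) := by
  rw [symmetrizedPolydisc_eq_setOf_lt]
  exact isOpen_logMaxRoot_lt n 0

theorem isConnected_symmetrizedPolydisc (n : ℕ) : IsConnected (symmetrizedPolydisc n) := by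
  rw [symmetrizedPolydisc_eq_image_ball]
  exact ((convex_ball _ _).isConnected (Metric.nonempty_ball.2 one_pos)).image _
    (continuous_symmetrization n).continuousOn

theorem sublevel_subset_image_closedBall {n : ℕ} (ε : ℝ) :
    {w ∈ symmetrizedPolydisc n | logMaxRoot n w < ((-ε : ℝ) : EReal)} ⊆
      symmetrization n '' Metric.closedBall 0 (Real.exp (-ε)) := by
  rintro w ⟨-, hw⟩
  obtain ⟨z, rfl⟩ := symmetrization_surjective n w
  refine ⟨z, ?_, rfl⟩
  rw [logMaxRoot_symmetrization, ← Real.log_exp (-ε), ← ENNReal.log_ofReal_of_pos (Real.exp_pos _),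
    ENNReal.log_lt_log_iff, ← ofReal_norm, ENNReal.ofReal_lt_ofReal_iff (Real.exp_pos _)] at hw
  simpa using hw.le

theorem isCompact_symmetrization_image_closedBall (n : ℕ) (r : ℝ) :
    IsCompact (symmetrization n '' Metric.closedBall 0 r) :=
  (isCompact_closedBall _ _).image (continuous_symmetrization n)

/-! ### The polynomials P_{k,m} and Jensen's inequality -/

theorem norm_symmetrization_le {n : ℕ} (z : Fin n → ℂ) (m : Fin n) :
    ‖symmetrization n z m‖ ≤ 2 ^ n * ‖z‖ ^ ((m : ℕ) + 1) := by
  have hcard : n.choose ((m : ℕ) + 1) ≤ 2 ^ n := Nat.choose_le_two_pow _ _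
  calc ‖symmetrization n z m‖
      ≤ ∑ s ∈ Finset.powersetCard ((m : ℕ) + 1) (Finset.univ : Finset (Fin n)),
          ‖z‖ ^ ((m : ℕ) + 1) := by
        refine norm_sum_le_of_le _ fun s hs => ?_
        rw [norm_prod, ← (Finset.mem_powersetCard.1 hs).2]
        exact (Finset.prod_le_prod (fun j _ => norm_nonneg _)
          fun j _ => norm_le_pi_norm z j).trans_eq (by simp)
    _ = n.choose ((m : ℕ) + 1) * ‖z‖ ^ ((m : ℕ) + 1) := by simp
    _ ≤ 2 ^ n * ‖z‖ ^ ((m : ℕ) + 1) := by gcongr; exact_mod_cast hcard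

open MvPolynomial in
theorem exists_mvPolynomial_eval_symmetrization {n : ℕ} (k : ℕ) (m : Fin n) :
    ∃ P : MvPolynomial (Fin n) ℂ, ∀ z : Fin n → ℂ,
      eval (symmetrization n z) P = symmetrization n (z ^ k) m := by
  have eval_esymm : ∀ (z : Fin n → ℂ) (i : Fin n),
      eval z (esymm (Fin n) ℂ (i + 1)) = symmetrization n z i := by
    intro z i
    simp [esymm, symmetrization]
  have hsymm : (expand k (esymm (Fin n) ℂ (m + 1))).IsSymmetric := fun e => by
    rw [rename_expand, esymm_isSymmetric]
  obtain ⟨P, hP⟩ := esymmAlgHom_surjective (σ := Fin n) ℂ (n := n) (by simp)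
    ⟨_, (mem_symmetricSubalgebra _).2 hsymm⟩
  refine ⟨P, fun z => ?_⟩
  have h := congrArg (fun Q : symmetricSubalgebra (Fin n) ℂ => eval z Q.1) hP
  simp only [esymmAlgHom_apply, eval_expand, eval_esymm] at h
  rw [← h, ← aeval_eq_eval, ← aeval_eq_eval]
  change _ = aeval z (aeval _ P)
  rw [← AlgHom.comp_apply, comp_aeval]
  simp only [aeval_eq_eval, eval_esymm]
  

theorem exists_polynomial_eval_eq {n : ℕ} (P : MvPolynomial (Fin n) ℂ) (a b : Fin n → ℂ) :
    ∃ q : Polynomial ℂ, ∀ ζ : ℂ, q.eval ζ = MvPolynomial.eval (a + ζ • b) P := by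
  refine ⟨MvPolynomial.aeval (fun i => Polynomial.C (a i) + Polynomial.X * Polynomial.C (b i)) P,
    fun ζ => ?_⟩
  rw [← Polynomial.coe_evalRingHom, MvPolynomial.aeval_def, MvPolynomial.hom_eval₂]
  rw [MvPolynomial.eval, MvPolynomial.coe_eval₂Hom]
  congr 1
  · ext; simp
  · funext i; simp [mul_comm ζ]

theorem Polynomial.log_norm_eval_zero_le_logMahlerMeasure (q : Polynomial ℂ)
    (hq : q.eval 0 ≠ 0) : Real.log ‖q.eval 0‖ ≤ q.logMahlerMeasure := by
  rw [q.logMahlerMeasure_eq_log_MahlerMeasure]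
  refine Real.log_le_log (norm_pos_iff.2 hq) ?_
  -- At index 0 the binomial factor is 1, which leaves Jensen's inequality.
  simpa [Polynomial.coeff_zero_eq_eval_zero] using q.norm_coeff_le_choose_mul_mahlerMeasure 0

theorem Polynomial.ae_eval_circleMap_ne_zero {q : Polynomial ℂ} (hq : q ≠ 0) :
    ∀ᵐ θ ∂(MeasureTheory.volume.restrict (Set.Ioc (0 : ℝ) (2 * Real.pi))),
      q.eval (circleMap 0 1 θ) ≠ 0 := by
  rw [MeasureTheory.ae_restrict_iff' measurableSet_Ioc]
  have hfin : {θ | θ ∈ Set.Ioc (0 : ℝ) (2 * Real.pi) ∧ q.eval (circleMap 0 1 θ) = 0}.Finite := by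
    refine Set.Finite.of_injOn (f := circleMap 0 1) (t := {x | q.IsRoot x}) (fun θ h => h.2) ?_
      (Polynomial.finite_setOfPred_isRoot hq)
    have h := injOn_circleMap_of_abs_sub_le (a := 0) (b := 2 * Real.pi) (c := 0) one_ne_zero
      (by simp [abs_of_pos Real.pi_pos])
    rw [Set.uIoc_of_le Real.two_pi_pos.le] at h
    exact h.mono fun θ h => h.1
  have h0 := hfin.measure_zero MeasureTheory.volume
  refine MeasureTheory.measure_mono_null (fun θ hθ => ?_) h0
  exact ⟨(Classical.not_imp.1 hθ).1, not_not.1 (Classical.not_imp.1 hθ).2⟩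

/-- If `g ≤ c - d * log ‖q‖` away from the zeros of `q` on the unit circle, then the mean of `g`
is at most the value of `c - d * log ‖q‖` at the centre. -/
theorem Polynomial.laverage_sub_log_norm_le {q : Polynomial ℂ} (hq : q.eval 0 ≠ 0) (c : ℝ) {d : ℝ}
    (hd : 0 ≤ d) {g : ℝ → ENNReal}
    (hg : ∀ θ, q.eval (circleMap 0 1 θ) ≠ 0 →
      0 ≤ c - d * Real.log ‖q.eval (circleMap 0 1 θ)‖ ∧
      g θ ≤ ENNReal.ofReal (c - d * Real.log ‖q.eval (circleMap 0 1 θ)‖)) :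
    MeasureTheory.laverage (MeasureTheory.volume.restrict (Set.Ioc (0 : ℝ) (2 * Real.pi))) g ≤
      ENNReal.ofReal (c - d * Real.log ‖q.eval 0‖) := by
  have hq0 : q ≠ 0 := by rintro rfl; simp at hq
  have hae := Polynomial.ae_eval_circleMap_ne_zero hq0
  have hpi := Real.two_pi_pos
  have hint : IntervalIntegrable (fun θ => c - d * Real.log ‖q.eval (circleMap 0 1 θ)‖)
      MeasureTheory.volume 0 (2 * Real.pi) :=
    intervalIntegrable_const.sub (q.intervalIntegrable_mahlerMeasure.const_mul d)
  have hion := (intervalIntegrable_iff_integrableOn_Ioc_of_le hpi.le).1 hint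
  have hmean : ∫ θ in (0 : ℝ)..2 * Real.pi, (c - d * Real.log ‖q.eval (circleMap 0 1 θ)‖)
      = 2 * Real.pi * (c - d * q.logMahlerMeasure) := by
    rw [intervalIntegral.integral_sub intervalIntegrable_const
      (q.intervalIntegrable_mahlerMeasure.const_mul d), intervalIntegral.integral_const_mul,
      intervalIntegral.integral_const, q.logMahlerMeasure_def, Real.circleAverage_def]
    simp only [smul_eq_mul]
    field_simp
    ring
  rw [MeasureTheory.laverage_eq, MeasureTheory.Measure.restrict_apply_univ, Real.volume_Ioc,
    sub_zero]
  refine ENNReal.div_le_of_le_mul ?_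
  calc _ ≤ ∫⁻ θ in Set.Ioc (0 : ℝ) (2 * Real.pi),
        ENNReal.ofReal (c - d * Real.log ‖q.eval (circleMap 0 1 θ)‖) :=
        MeasureTheory.lintegral_mono_ae (hae.mono fun θ h => (hg θ h).2)
    _ = ENNReal.ofReal (2 * Real.pi * (c - d * q.logMahlerMeasure)) := by
        rw [← MeasureTheory.ofReal_integral_eq_lintegral_ofReal hion
          (hae.mono fun θ h => (hg θ h).1), ← intervalIntegral.integral_of_le hpi.le, hmean]
    _ ≤ ENNReal.ofReal (c - d * Real.log ‖q.eval 0‖) * ENNReal.ofReal (2 * Real.pi) := by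
        rw [mul_comm, ENNReal.ofReal_mul' hpi.le]
        gcongr
        exact q.log_norm_eval_zero_le_logMahlerMeasure hq

/-- Otherwise all n lower terms of the monic equation satisfied by -z_j^k, with |z_j| = ‖z‖, would
have modulus below 1/n of the leading term. -/
theorem exists_norm_pow_le_norm_symmetrization_pow {n : ℕ} {z : Fin n → ℂ} (hz : z ≠ 0) (k : ℕ) :
    ∃ m : Fin n, ‖z‖ ^ (k * ((m : ℕ) + 1)) ≤ n * ‖symmetrization n (z ^ k) m‖ := by
  obtain ⟨i, -⟩ := Function.ne_iff.1 hz
  have hne : (Finset.univ : Finset (Fin n)).Nonempty := ⟨i, Finset.mem_univ i⟩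
  obtain ⟨j, -, hj⟩ := Finset.exists_max_image Finset.univ (fun j => ‖z j‖) hne
  have hjz : ‖z j‖ = ‖z‖ := le_antisymm (norm_le_pi_norm z j)
    ((pi_norm_le_iff_of_nonneg (norm_nonneg _)).2 fun i => hj i (Finset.mem_univ i))
  have hρ : 0 < ‖z‖ ^ k := pow_pos (norm_pos_iff.2 hz) k
  by_contra! hlt
  have h := norm_pow_le_sum_norm_symmetrization (z ^ k) j
  rw [Pi.pow_apply, norm_pow, hjz] at h
  have hsum : ∑ m : Fin n, (n * ‖symmetrization n (z ^ k) m‖) * (‖z‖ ^ k) ^ (n - 1 - (m : ℕ)) <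
      ∑ _m : Fin n, (‖z‖ ^ k) ^ n := by
    refine Finset.sum_lt_sum_of_nonempty hne fun m _ => ?_
    have hm := hlt m
    rw [pow_mul] at hm
    refine (mul_lt_mul_of_pos_right hm (pow_pos hρ _)).trans_eq ?_
    rw [← pow_add]
    congr 1
    have := m.isLt
    omega
  rw [Finset.sum_const, Finset.card_univ, Fintype.card_fin, nsmul_eq_mul] at hsum
  simp only [mul_assoc, ← Finset.mul_sum] at hsum
  exact absurd (mul_le_mul_of_nonneg_left h n.cast_nonneg) (not_le.2 hsum)

theorem log_enorm_eq_coe_log_norm {E : Type*} [NormedAddCommGroup E] {z : E} (hz : z ≠ 0) :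
    ENNReal.log ‖z‖ₑ = (Real.log ‖z‖ : EReal) := by
  rw [← ofReal_norm, ENNReal.log_ofReal_of_pos (norm_pos_iff.2 hz)]

/-! ### The sub-mean value inequality and conclusion -/

theorem laverage_neg_logMaxRoot_le_add {n : ℕ} {α b : Fin n → ℂ} (hα : α ≠ 0)
    (hD : ∀ ζ : ℂ, ‖ζ‖ = 1 → symmetrization n α + ζ • b ∈ symmetrizedPolydisc n)
    {k : ℕ} (hk : 0 < k) :
    MeasureTheory.laverage (MeasureTheory.volume.restrict (Set.Ioc (0 : ℝ) (2 * Real.pi)))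
      (fun θ => (-logMaxRoot n (symmetrization n α + circleMap 0 1 θ • b)).toENNReal) ≤
    ENNReal.ofReal (-Real.log ‖α‖ + (n * Real.log 2 + Real.log n) / k) := by
  -- The index m only has to be good at the centre; on the circle the upper bound holds for every m.
  obtain ⟨m, hm⟩ := exists_norm_pow_le_norm_symmetrization_pow hα k
  obtain ⟨P, hP⟩ := exists_mvPolynomial_eval_symmetrization k m
  obtain ⟨q, hq⟩ := exists_polynomial_eval_eq P (symmetrization n α) b
  have hn : 0 < n := m.pos
  have hα' : 0 < ‖α‖ := norm_pos_iff.2 hα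
  set d : ℝ := ((k * ((m : ℕ) + 1) : ℕ) : ℝ) with hd
  have hdk : (k : ℝ) ≤ d := by rw [hd]; exact_mod_cast Nat.le_mul_of_pos_right k m.val.succ_pos
  have hk' : (0 : ℝ) < k := by exact_mod_cast hk
  have hdpos : 0 < d := hk'.trans_le hdk
  have hq0 : q.eval 0 = symmetrization n (α ^ k) m := by rw [hq, zero_smul, add_zero, hP]
  have hpos : 0 < ‖q.eval 0‖ := by
    rw [hq0]
    exact pos_of_mul_pos_right ((pow_pos hα' _).trans_le hm) n.cast_nonneg
  refine (Polynomial.laverage_sub_log_norm_le (norm_pos_iff.1 hpos) (n * Real.log 2 / d)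
    (inv_nonneg.2 hdpos.le) fun θ hθ => ?_).trans (ENNReal.ofReal_le_ofReal ?_)
  · obtain ⟨z, hz⟩ := symmetrization_surjective n (symmetrization n α + circleMap 0 1 θ • b)
    have hmem := hD (circleMap 0 1 θ) (by simp)
    rw [symmetrizedPolydisc_eq_setOf_lt, Set.mem_ofPred_eq] at hmem
    rw [← hz, logMaxRoot_symmetrization] at hmem ⊢
    rw [hq, ← hz, hP] at hθ ⊢
    have hz0 : z ≠ 0 := by
      rintro rfl
      refine hθ (norm_le_zero_iff.1 ((norm_symmetrization_le _ m).trans_eq ?_))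
      rw [zero_pow hk.ne', norm_zero, zero_pow m.val.succ_ne_zero, mul_zero]
    rw [log_enorm_eq_coe_log_norm hz0] at hmem ⊢
    have hneg : Real.log ‖z‖ < 0 := by exact_mod_cast hmem
    have hupper : Real.log ‖symmetrization n (z ^ k) m‖ ≤ n * Real.log 2 + d * Real.log ‖z‖ := by
      rw [hd, ← Real.log_pow, ← Real.log_pow, ← Real.log_mul (by positivity)
        (pow_ne_zero _ (norm_ne_zero_iff.2 hz0)), pow_mul]
      refine Real.log_le_log (norm_pos_iff.2 hθ) ((norm_symmetrization_le _ m).trans ?_)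
      gcongr
      refine (pi_norm_le_iff_of_nonneg (by positivity)).2 fun j => ?_
      rw [Pi.pow_apply, norm_pow]
      gcongr
      exact norm_le_pi_norm z j
    have hle : -Real.log ‖z‖ ≤
        n * Real.log 2 / d - d⁻¹ * Real.log ‖symmetrization n (z ^ k) m‖ := by
      rw [inv_mul_eq_div, ← sub_div, le_div_iff₀ hdpos]
      linarith
    refine ⟨(neg_pos.2 hneg).le.trans hle, ?_⟩
    rw [← EReal.coe_neg, EReal.real_coe_toENNReal]
    exact ENNReal.ofReal_le_ofReal hle
  · have hlower : d * Real.log ‖α‖ ≤ Real.log n + Real.log ‖q.eval 0‖ := by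
      rw [hd, ← Real.log_pow, ← Real.log_mul (by positivity) hpos.ne', hq0]
      exact Real.log_le_log (pow_pos hα' _) hm
    have hC : 0 ≤ n * Real.log 2 + Real.log n :=
      add_nonneg (by positivity) (Real.log_natCast_nonneg n)
    calc n * Real.log 2 / d - d⁻¹ * Real.log ‖q.eval 0‖
        ≤ -Real.log ‖α‖ + (n * Real.log 2 + Real.log n) / d := by
          rw [inv_mul_eq_div, ← sub_div, div_le_iff₀ hdpos, add_mul, div_mul_cancel₀ _ hdpos.ne']
          linarith
      _ ≤ _ := by gcongr

theorem logMaxRoot_le_unitCircleMean {n : ℕ} {a b : Fin n → ℂ}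
    (hD : ∀ ζ : ℂ, ‖ζ‖ ≤ 1 → a + ζ • b ∈ symmetrizedPolydisc n) :
    logMaxRoot n a ≤ unitCircleMean fun ζ => logMaxRoot n (a + ζ • b) := by
  obtain ⟨α, rfl⟩ := symmetrization_surjective n a
  rw [logMaxRoot_symmetrization]
  rcases eq_or_ne α 0 with rfl | hα
  · simp
  -- Although m varies with k, the error bound depends only on k and n, and it tends to 0.
  have hlim : Filter.Tendsto
      (fun k : ℕ => ENNReal.ofReal (-Real.log ‖α‖ + (n * Real.log 2 + Real.log n) / k))
      Filter.atTop (nhds (ENNReal.ofReal (-Real.log ‖α‖))) := by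
    refine ENNReal.tendsto_ofReal ?_
    simpa using (tendsto_const_div_atTop_nhds_zero_nat (n * Real.log 2 + Real.log n)).const_add
      (-Real.log ‖α‖)
  have hle := ge_of_tendsto hlim ((Filter.eventually_gt_atTop 0).mono fun k hk =>
    laverage_neg_logMaxRoot_le_add hα (fun ζ hζ => hD ζ hζ.le) hk)
  -- Since u < 0 on the disc, only the negative part contributes to the mean.
  have hpos : ∀ θ, (logMaxRoot n (symmetrization n α + circleMap 0 1 θ • b)).toENNReal = 0 := by
    intro θ
    have hmem := hD (circleMap 0 1 θ) (by simp)
    rw [symmetrizedPolydisc_eq_setOf_lt] at hmem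
    exact EReal.toENNReal_of_nonpos (le_of_lt hmem)
  rw [unitCircleMean]
  simp only [hpos, MeasureTheory.laverage_zero, EReal.coe_ennreal_zero, zero_sub]
  have hneg := hD 0 (by simp)
  rw [zero_smul, add_zero, symmetrizedPolydisc_eq_setOf_lt, Set.mem_ofPred_eq,
    logMaxRoot_symmetrization] at hneg
  rw [log_enorm_eq_coe_log_norm hα] at hneg ⊢
  have hneg' : Real.log ‖α‖ < 0 := by exact_mod_cast hneg
  rw [EReal.le_neg, ← EReal.coe_neg]
  refine (EReal.coe_ennreal_le_coe_ennreal_iff.2 hle).trans_eq ?_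
  rw [EReal.coe_ennreal_ofReal, max_eq_left (neg_nonneg.2 hneg'.le)]

theorem isNegPSHExhaustion_logMaxRoot {n : ℕ} (hn : 1 ≤ n) :
    IsNegPSHExhaustion (logMaxRoot n) (symmetrizedPolydisc n) where
  psh :=
    { lt_top := fun z hz => by
        rw [symmetrizedPolydisc_eq_setOf_lt] at hz
        exact lt_trans hz EReal.zero_lt_top
      ne_bot := fun z hz => by
        rw [(isConnected_symmetrizedPolydisc n).isPreconnected.connectedComponentIn hz,
          symmetrizedPolydisc_eq_image_ball]
        have : NeZero n := ⟨by omega⟩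
        refine ⟨_, ⟨fun _ => 1 / 2, ?_, rfl⟩, ?_⟩
        · rw [mem_ball_zero_iff, pi_norm_const]
          norm_num
        · rw [logMaxRoot_symmetrization, Ne, ENNReal.log_eq_bot_iff, enorm_eq_zero]
          exact fun h => by simpa using congrFun h 0
      upperSemicontinuousOn := fun z _ c hc =>
        mem_nhdsWithin_of_mem_nhds ((isOpen_logMaxRoot_lt n c).mem_nhds hc)
      le_mean := fun _ _ hD => logMaxRoot_le_unitCircleMean hD }
  neg := fun z hz => by rwa [symmetrizedPolydisc_eq_setOf_lt] at hz
  isCompact_closure := fun ε _ =>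
    (isCompact_symmetrization_image_closedBall n _).closure_of_subset
      (sublevel_subset_image_closedBall ε)
  closure_subset := fun ε hε => by
    refine (closure_minimal (sublevel_subset_image_closedBall ε)
      (isCompact_symmetrization_image_closedBall n _).isClosed).trans ?_
    rw [symmetrizedPolydisc_eq_image_ball]
    exact Set.image_mono (Metric.closedBall_subset_ball (by simpa using hε))

theorem proposition16 (n : ℕ) (hn : 1 ≤ n) :
    IsHyperconvexDomain (symmetrizedPolydisc n) ∧
      (∀ w : Fin n → ℂ,
        IsGreatest (logMaxAbs '' (symmetrization n ⁻¹' {w})) (logMaxRoot n w)) ∧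
      IsNegPSHExhaustion (logMaxRoot n) (symmetrizedPolydisc n) :=
  ⟨⟨isOpen_symmetrizedPolydisc n, isConnected_symmetrizedPolydisc n, _,
    isNegPSHExhaustion_logMaxRoot hn⟩, isGreatest_logMaxRoot n, isNegPSHExhaustion_logMaxRoot hn⟩
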